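/- Let $\mathbb K\in\{\mathbb R,\mathbb C\}$, $N\ge 1$, let $\Omega\subseteq\mathbb R^N$ be open and bounded, and let $0<\alpha<\beta$. All function spaces are $\mathbb K$-valued and inner products are anti-linear in the first argument. Let $H^1_0(\Omega)$ be the closure of $C_c^\infty(\Omega)$ in $H^1(\Omega)$, let $H^{-1}(\Omega)$ be its dual, put $g_0(\Omega):=\{\nabla u: u\in H_0^1(\Omega)\}\subseteq L^2(\Omega)^N$, and let $\iota_{g_0}\colon g_0(\Omega)\to L^2(\Omega)^N$ be the canonical embedding. Set $$M(\alpha,\beta,\Omega):=\{a\in L^\infty(\Omega;\mathbb K^{N\times N}):\ \operatorname{Re}a(x)\ge\alpha,\ \operatorname{Re}a(x)^{-1}\ge 1/\beta\ \text{for a.e. }x\in\Omega\},$$ and let $M_{\rm sym}(\alpha,\beta,\Omega)$ be the set of those $a\in M(\alpha,\beta,\Omega)$ for which $a(x)$ is real and symmetric for a.e. $x$. A coefficient $a$ is identified with the operator of multiplication by $a$ on $L^2(\Omega)^N$. For $(a_n)_n$ and $a$ in $M_{\rm sym}(\alpha,\beta,\Omega)$, $(a_n)_n$ *$G$-converges*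 to $a$ if for all $f\in H^{-1}(\Omega)$ and all $u_n\in H_0^1(\Omega)$ with $\langle a_n\nabla u_n,\nabla\phi\rangle=f(\phi)$ for all $\phi\in H^1_0(\Omega)$ and $n\in\mathbb N$, one has $u_n\rightharpoonup u$ in $H_0^1(\Omega)$ for some $u\in H^1_0(\Omega)$ with $\langle a\nabla u,\nabla\phi\rangle=f(\phi)$ for all $\phi\in H_0^1(\Omega)$. For $(a_n)_n$ and $a$ in $M(\alpha,\beta,\Omega)$, $(a_n)_n$ *$H$-converges* to $a$ if, under the same premise, in addition $a_n\nabla u_n\rightharpoonup a\nabla u$ in $L^2(\Omega)^N$ for this $u$. Then $g_0(\Omega)$ is a Hilbert space (a closed subspace of $L^2(\Omega)^N$), for each $a\in M(\alpha,\beta,\Omega)$ the operator $\iota_{g_0}^*a\iota_{g_0}$ is boundedly invertible on $g_0(\Omega)$, and the following hold. (a) Let $(a_n)_n$ and $a$ be in $M_{\rm sym}(\alpha,\beta,\Omega)$. Then $(a_n)_n$ $G$-converges to $a$ if and only if $(\iota_{g_0}^*a_n\iota_{g_0})^{-1}\to(\iota_{g_0}^*a\iota_{g_0})^{-1}$ in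 the weak operator topology of $\mathcal B(g_0(\Omega))$. (b) Let $(a_n)_n$ and $a$ be in $M(\alpha,\beta,\Omega)$. Then $(a_n)_n$ $H$-converges to $a$ if and only if $(\iota_{g_0}^*a_n\iota_{g_0})^{-1}\to(\iota_{g_0}^*a\iota_{g_0})^{-1}$ in the weak operator topology of $\mathcal B(g_0(\Omega))$ and $a_n\iota_{g_0}(\iota_{g_0}^*a_n\iota_{g_0})^{-1}\to a\iota_{g_0}(\iota_{g_0}^*a\iota_{g_0})^{-1}$ in the weak operator topology of $\mathcal B(g_0(\Omega),L^2(\Omega)^N)$. -/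

import Mathlib

namespace Homogenisation

open MeasureTheory TopologicalSpace Filter Topology
open scoped Distributions ENNReal

noncomputable section

/-- The space `𝕜^N`, with its Euclidean inner product. -/
abbrev Vec (𝕜 : Type*) [RCLike 𝕜] (N : ℕ) : Type _ := EuclideanSpace 𝕜 (Fin N)

/-- Lebesgue measure on `Ω`. -/
abbrev vol {N : ℕ} (Ω : Opens (Vec ℝ N)) : Measure (Vec ℝ N) :=
  volume.restrict (Ω : Set (Vec ℝ N))

/-- The Hilbert space `L²(Ω)`. -/
abbrev L2 (𝕜 : Type*) [RCLike 𝕜] {N : ℕ} (Ω : Opens (Vec ℝ N)) : Type _ :=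
  Lp 𝕜 2 (vol Ω)

/-- The Hilbert space `L²(Ω)^N`. -/
abbrev L2Vec (𝕜 : Type*) [RCLike 𝕜] {N : ℕ} (Ω : Opens (Vec ℝ N)) : Type _ :=
  Lp (Vec 𝕜 N) 2 (vol Ω)

/-- The partial derivative `∂ᵢ φ` of a test function. -/
def partialDeriv {𝕜 : Type*} [RCLike 𝕜] {N : ℕ} {Ω : Opens (Vec ℝ N)}
    (φ : 𝓓(Ω, 𝕜)) (i : Fin N) (x : Vec ℝ N) : 𝕜 :=
  fderiv ℝ φ x (EuclideanSpace.single i (1 : ℝ))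

/-- `v` is the weak gradient of `u` on `Ω`. -/
def IsWeakGradient {𝕜 : Type*} [RCLike 𝕜] {N : ℕ} {Ω : Opens (Vec ℝ N)}
    (u : L2 𝕜 Ω) (v : L2Vec 𝕜 Ω) : Prop :=
  ∀ (φ : 𝓓(Ω, 𝕜)) (i : Fin N),
    ∫ x, u x * partialDeriv φ i x ∂(vol Ω) = -∫ x, v x i * φ x ∂(vol Ω)

theorem continuous_partialDeriv {𝕜 : Type*} [RCLike 𝕜] {N : ℕ} {Ω : Opens (Vec ℝ N)}
    (φ : 𝓓(Ω, 𝕜)) (i : Fin N) : Continuous (partialDeriv φ i) :=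
  (φ.contDiff.continuous_fderiv (by simp)).clm_apply continuous_const

theorem integrable_mul_partialDeriv {𝕜 : Type*} [RCLike 𝕜] {N : ℕ} {Ω : Opens (Vec ℝ N)}
    (u : L2 𝕜 Ω) (φ : 𝓓(Ω, 𝕜)) (i : Fin N) :
    Integrable (fun x => u x * partialDeriv φ i x) (vol Ω) := by
  have h : MemLp (partialDeriv φ i) 2 (vol Ω) :=
    (continuous_partialDeriv φ i).memLp_of_hasCompactSupport
      (φ.hasCompactSupport.fderiv_apply ℝ _)
  exact (Lp.memLp u).integrable_mul h

theorem integrable_coord_mul {𝕜 : Type*} [RCLike 𝕜] {N : ℕ} {Ω : Opens (Vec ℝ N)}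
    (v : L2Vec 𝕜 Ω) (φ : 𝓓(Ω, 𝕜)) (i : Fin N) :
    Integrable (fun x => v x i * φ x) (vol Ω) := by
  have h : MemLp (φ : Vec ℝ N → 𝕜) 2 (vol Ω) :=
    φ.continuous.memLp_of_hasCompactSupport φ.hasCompactSupport
  have h' : MemLp (fun x => v x i) 2 (vol Ω) :=
    (Lp.memLp v).continuousLinearMap_comp (EuclideanSpace.proj (𝕜 := 𝕜) i)
  exact h'.integrable_mul h

/-- The Sobolev space `H¹(Ω)`: an element is recorded as the pair `(u, grad u)` of a function in
`L²(Ω)` and its weak gradient in `L²(Ω)^N`, so that the inherited norm is the usual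
norm `(‖u‖² + ‖grad u‖²)^(1/2)`. -/
def H1 (𝕜 : Type*) [RCLike 𝕜] {N : ℕ} (Ω : Opens (Vec ℝ N)) :
    Submodule 𝕜 (WithLp 2 (L2 𝕜 Ω × L2Vec 𝕜 Ω)) where
  carrier := {p | IsWeakGradient p.fst p.snd}
  zero_mem' := by
    intro φ i
    have h1 : ∫ x, (0 : L2 𝕜 Ω) x * partialDeriv φ i x ∂(vol Ω) = 0 := by
      refine integral_eq_zero_of_ae ?_
      filter_upwards [Lp.coeFn_zero 𝕜 2 (vol Ω)] with x hx
      rw [hx]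
      simp
    have h2 : ∫ x, (0 : L2Vec 𝕜 Ω) x i * φ x ∂(vol Ω) = 0 := by
      refine integral_eq_zero_of_ae ?_
      filter_upwards [Lp.coeFn_zero (Vec 𝕜 N) 2 (vol Ω)] with x hx
      rw [hx]
      simp
    change ∫ x, (0 : L2 𝕜 Ω) x * partialDeriv φ i x ∂(vol Ω)
      = -∫ x, (0 : L2Vec 𝕜 Ω) x i * φ x ∂(vol Ω)
    rw [h1, h2, neg_zero]
  add_mem' := by
    intro p q hp hq φ i
    have h1 : ∫ x, (p.fst + q.fst) x * partialDeriv φ i x ∂(vol Ω)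
        = ∫ x, p.fst x * partialDeriv φ i x ∂(vol Ω)
          + ∫ x, q.fst x * partialDeriv φ i x ∂(vol Ω) := by
      rw [← integral_add (integrable_mul_partialDeriv _ φ i) (integrable_mul_partialDeriv _ φ i)]
      refine integral_congr_ae ?_
      filter_upwards [Lp.coeFn_add p.fst q.fst] with x hx
      rw [hx]
      simp [add_mul]
    have h2 : ∫ x, (p.snd + q.snd) x i * φ x ∂(vol Ω)
        = ∫ x, p.snd x i * φ x ∂(vol Ω) + ∫ x, q.snd x i * φ x ∂(vol Ω) := by
      rw [← integral_add (integrable_coord_mul _ φ i) (integrable_coord_mul _ φ i)]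
      refine integral_congr_ae ?_
      filter_upwards [Lp.coeFn_add p.snd q.snd] with x hx
      rw [hx]
      simp [add_mul]
    change ∫ x, (p.fst + q.fst) x * partialDeriv φ i x ∂(vol Ω)
      = -∫ x, (p.snd + q.snd) x i * φ x ∂(vol Ω)
    rw [h1, h2, hp φ i, hq φ i, neg_add]
  smul_mem' := by
    intro c p hp φ i
    have h1 : ∫ x, (c • p.fst) x * partialDeriv φ i x ∂(vol Ω)
        = c * ∫ x, p.fst x * partialDeriv φ i x ∂(vol Ω) := by
      rw [← integral_const_mul]
      refine integral_congr_ae ?_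
      filter_upwards [Lp.coeFn_smul c p.fst] with x hx
      rw [hx]
      simp [mul_assoc]
    have h2 : ∫ x, (c • p.snd) x i * φ x ∂(vol Ω) = c * ∫ x, p.snd x i * φ x ∂(vol Ω) := by
      rw [← integral_const_mul]
      refine integral_congr_ae ?_
      filter_upwards [Lp.coeFn_smul c p.snd] with x hx
      rw [hx]
      simp [mul_assoc]
    change ∫ x, (c • p.fst) x * partialDeriv φ i x ∂(vol Ω)
      = -∫ x, (c • p.snd) x i * φ x ∂(vol Ω)
    rw [h1, h2, hp φ i, mul_neg]

/-- `H¹₀(Ω)`: the closure of the test functions `C_c^∞(Ω)` in `H¹(Ω)`. -/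
def H10 (𝕜 : Type*) [RCLike 𝕜] {N : ℕ} (Ω : Opens (Vec ℝ N)) : Submodule 𝕜 (H1 𝕜 Ω) :=
  (Submodule.span 𝕜
    {p : H1 𝕜 Ω | ∃ φ : 𝓓(Ω, 𝕜), p.1.fst =ᵐ[vol Ω] φ}).topologicalClosure

/-- The gradient `H¹₀(Ω) → L²(Ω)^N`. -/
def grad (𝕜 : Type*) [RCLike 𝕜] {N : ℕ} (Ω : Opens (Vec ℝ N)) : H10 𝕜 Ω →L[𝕜] L2Vec 𝕜 Ω :=
  WithLp.sndL 2 𝕜 (L2 𝕜 Ω) (L2Vec 𝕜 Ω) ∘L (H1 𝕜 Ω).subtypeL ∘L (H10 𝕜 Ω).subtypeL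

/-- `g₀(Ω) = grad[H¹₀(Ω)]`. -/
def g0 (𝕜 : Type*) [RCLike 𝕜] {N : ℕ} (Ω : Opens (Vec ℝ N)) : Submodule 𝕜 (L2Vec 𝕜 Ω) :=
  (grad 𝕜 Ω).range

/-- The canonical embedding of `g₀(Ω)` into `L²(Ω)^N`. -/
def iota (𝕜 : Type*) [RCLike 𝕜] {N : ℕ} (Ω : Opens (Vec ℝ N)) : g0 𝕜 Ω →L[𝕜] L2Vec 𝕜 Ω :=
  (g0 𝕜 Ω).subtypeL

/-- Coefficients `L^∞(Ω)^{N × N}`; an `N × N` matrix is identified with the linear map on `𝕜^N`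
that it induces. -/
abbrev Coeff (𝕜 : Type*) [RCLike 𝕜] {N : ℕ} (Ω : Opens (Vec ℝ N)) : Type _ :=
  Lp (Vec 𝕜 N →L[𝕜] Vec 𝕜 N) ∞ (vol Ω)

/-- The operator `q ↦ (x ↦ a(x) q(x))` of multiplication by the coefficient `a` on `L²(Ω)^N`. -/
def mulOp {𝕜 : Type*} [RCLike 𝕜] {N : ℕ} {Ω : Opens (Vec ℝ N)} (a : Coeff 𝕜 Ω) :
    L2Vec 𝕜 Ω →L[𝕜] L2Vec 𝕜 Ω :=
  (ContinuousLinearMap.id 𝕜 (Vec 𝕜 N →L[𝕜] Vec 𝕜 N)).holderL (vol Ω) ∞ 2 2 a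

/-- The admissible coefficients `M(α, β, Ω)`: `Re a(x) ≥ α` and `Re a(x)⁻¹ ≥ 1/β` for almost
every `x ∈ Ω`. -/
def M (𝕜 : Type*) [RCLike 𝕜] {N : ℕ} (α β : ℝ) (Ω : Opens (Vec ℝ N)) : Set (Coeff 𝕜 Ω) :=
  {a | ∀ᵐ x ∂(vol Ω), (a x).IsInvertible ∧
    (∀ ξ : Vec 𝕜 N, α * ‖ξ‖ ^ 2 ≤ RCLike.re (inner 𝕜 (a x ξ) ξ)) ∧
    (∀ ξ : Vec 𝕜 N, 1 / β * ‖ξ‖ ^ 2 ≤ RCLike.re (inner 𝕜 ((a x).inverse ξ) ξ))}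

/-- The real symmetric admissible coefficients `M_sym(α, β, Ω)`. -/
def Msym (𝕜 : Type*) [RCLike 𝕜] {N : ℕ} (α β : ℝ) (Ω : Opens (Vec ℝ N)) : Set (Coeff 𝕜 Ω) :=
  {a | a ∈ M 𝕜 α β Ω ∧ ∀ᵐ x ∂(vol Ω), ∃ B : Matrix (Fin N) (Fin N) ℝ,
    B.IsSymm ∧ a x = Matrix.toEuclideanCLM (𝕜 := 𝕜) (B.map (algebraMap ℝ 𝕜))}

/-- `u ∈ H¹₀(Ω)` satisfies `⟨a grad u, grad φ⟩ = f(φ)` for all `φ ∈ H¹₀(Ω)`, where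
`f ∈ H⁻¹(Ω) = H¹₀(Ω)*`. -/
def IsSolution {𝕜 : Type*} [RCLike 𝕜] {N : ℕ} {Ω : Opens (Vec ℝ N)} (a : Coeff 𝕜 Ω)
    (f : StrongDual 𝕜 (H10 𝕜 Ω)) (u : H10 𝕜 Ω) : Prop :=
  ∀ φ : H10 𝕜 Ω, inner 𝕜 (mulOp a (grad 𝕜 Ω u)) (grad 𝕜 Ω φ) = f φ

/-- Weak convergence `x n ⇀ y` of a sequence. -/
def WeaklyTendsto (𝕜 : Type*) [RCLike 𝕜] {H : Type*} [NormedAddCommGroup H]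
    [InnerProductSpace 𝕜 H] (x : ℕ → H) (y : H) : Prop :=
  Tendsto (fun n => toWeakSpace 𝕜 H (x n)) atTop (𝓝 (toWeakSpace 𝕜 H y))

/-- `G`-convergence of coefficients. -/
def GConverges {𝕜 : Type*} [RCLike 𝕜] {N : ℕ} {Ω : Opens (Vec ℝ N)} (a : ℕ → Coeff 𝕜 Ω)
    (b : Coeff 𝕜 Ω) : Prop :=
  ∀ (f : StrongDual 𝕜 (H10 𝕜 Ω)) (u : ℕ → H10 𝕜 Ω), (∀ n, IsSolution (a n) f (u n)) →
    ∃ v : H10 𝕜 Ω, WeaklyTendsto 𝕜 u v ∧ IsSolution b f v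

/-- `H`-convergence of coefficients. -/
def HConverges {𝕜 : Type*} [RCLike 𝕜] {N : ℕ} {Ω : Opens (Vec ℝ N)} (a : ℕ → Coeff 𝕜 Ω)
    (b : Coeff 𝕜 Ω) : Prop :=
  ∀ (f : StrongDual 𝕜 (H10 𝕜 Ω)) (u : ℕ → H10 𝕜 Ω), (∀ n, IsSolution (a n) f (u n)) →
    ∃ v : H10 𝕜 Ω, WeaklyTendsto 𝕜 u v ∧
      WeaklyTendsto 𝕜 (fun n => mulOp (a n) (grad 𝕜 Ω (u n))) (mulOp b (grad 𝕜 Ω v)) ∧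
      IsSolution b f v

/-- The operator `ι* a ι` on `g₀(Ω)`, where `ι` is the canonical embedding. -/
def compression {𝕜 : Type*} [RCLike 𝕜] {N : ℕ} {Ω : Opens (Vec ℝ N)} [CompleteSpace (g0 𝕜 Ω)]
    (a : Coeff 𝕜 Ω) : g0 𝕜 Ω →L[𝕜] g0 𝕜 Ω :=
  ContinuousLinearMap.adjoint (iota 𝕜 Ω) ∘L mulOp a ∘L iota 𝕜 Ω

/-- Convergence of a sequence of bounded operators in the weak operator topology. -/
def WOTTendsto {𝕜 : Type*} [RCLike 𝕜] {H K : Type*} [NormedAddCommGroup H]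
    [InnerProductSpace 𝕜 H] [NormedAddCommGroup K] [InnerProductSpace 𝕜 K]
    (T : ℕ → H →L[𝕜] K) (S : H →L[𝕜] K) : Prop :=
  Tendsto (fun n => ContinuousLinearMapWOT.ofCLM (T n)) atTop
    (𝓝 (ContinuousLinearMapWOT.ofCLM S))

end

end Homogenisation

open Homogenisation

/-!
The gradient is bounded below on `H¹₀(Ω)`: for a test function `φ`, testing its weak gradient
against `xᵢ * conj φ` and integrating by parts gives `‖φ‖² = -2 Re ∫ ∂ᵢφ xᵢ conj φ`, which is the
Poincaré inequality. Hence `grad : H¹₀(Ω) → g₀(Ω)` is an isomorphism of Banach spaces, and by Riesz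
every `f ∈ H⁻¹(Ω)` is `φ ↦ ⟨ι g, grad φ⟩` for exactly one `g ∈ g₀(Ω)`. In these terms the equation
`⟨a grad u, grad φ⟩ = f(φ)` reads `(ι* a ι) (grad u) = g`, so `grad u = (ι* a ι)⁻¹ g` and
`a grad u = a ι (ι* a ι)⁻¹ g`: letting `f` range over `H⁻¹(Ω)` amounts to letting `g` range over
`g₀(Ω)`, and weak convergence for every `g` is convergence in the weak operator topology.
-/

namespace Homogenisation

open MeasureTheory TopologicalSpace Filter Topology
open scoped Distributions ENNReal ComplexConjugate

section Lp

variable {X : Type*} [MeasurableSpace X] {μ : Measure X}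

theorem continuous_integral_bilin {𝕜 E F G : Type*} [NontriviallyNormedField 𝕜]
    [NormedAddCommGroup E] [NormedSpace 𝕜 E] [NormedAddCommGroup F] [NormedSpace 𝕜 F]
    [NormedAddCommGroup G] [NormedSpace 𝕜 G] [NormedSpace ℝ G] [SMulCommClass ℝ 𝕜 G]
    [CompleteSpace G] {p q : ℝ≥0∞} [p.HolderConjugate q] [Fact (1 ≤ p)] [Fact (1 ≤ q)]
    (B : E →L[𝕜] F →L[𝕜] G) {g : X → F} (hg : MemLp g q μ) :
    Continuous fun f : Lp E p μ => ∫ x, B (f x) (g x) ∂μ := by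
  refine ((B.lpPairing μ p q).flip (hg.toLp g)).continuous.congr fun f => ?_
  rw [ContinuousLinearMap.flip_apply, ContinuousLinearMap.lpPairing_eq_integral]
  refine integral_congr_ae ?_
  filter_upwards [hg.coeFn_toLp] with x hx
  rw [hx]

variable {E F : Type*} [NormedAddCommGroup E] [NormedAddCommGroup F]

theorem inner_toLp_norm (f : Lp E 2 μ) (g : Lp F 2 μ) :
    inner ℝ ((Lp.memLp f).norm.toLp) ((Lp.memLp g).norm.toLp) = ∫ x, ‖f x‖ * ‖g x‖ ∂μ := by
  rw [L2.inner_def]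
  refine integral_congr_ae ?_
  filter_upwards [(Lp.memLp f).norm.coeFn_toLp, (Lp.memLp g).norm.coeFn_toLp] with x hf hg
  rw [hf, hg, real_inner_comm, RCLike.inner_apply, conj_trivial]

theorem norm_toLp_norm {p : ℝ≥0∞} (f : Lp E p μ) : ‖(Lp.memLp f).norm.toLp‖ = ‖f‖ := by
  rw [Lp.norm_toLp, eLpNorm_norm, Lp.norm_def]

theorem integral_norm_sq_eq_norm_sq (f : Lp E 2 μ) : ∫ x, ‖f x‖ ^ 2 ∂μ = ‖f‖ ^ 2 := by
  simp only [sq, ← inner_toLp_norm, real_inner_self_eq_norm_mul_norm, norm_toLp_norm]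

theorem integral_norm_mul_norm_le (f : Lp E 2 μ) (g : Lp F 2 μ) :
    ∫ x, ‖f x‖ * ‖g x‖ ∂μ ≤ ‖f‖ * ‖g‖ := by
  rw [← inner_toLp_norm, ← norm_toLp_norm f, ← norm_toLp_norm g]
  exact real_inner_le_norm _ _

theorem integrable_norm_mul_norm (f : Lp E 2 μ) (g : Lp F 2 μ) :
    Integrable (fun x => ‖f x‖ * ‖g x‖) μ :=
  (Lp.memLp f).norm.integrable_mul (Lp.memLp g).norm

end Lp

variable {𝕜 : Type*} [RCLike 𝕜] {N : ℕ} {Ω : Opens (Vec ℝ N)}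

section Poincare

theorem memLp_testFunction (φ : 𝓓(Ω, 𝕜)) (p : ℝ≥0∞) : MemLp φ p (vol Ω) :=
  φ.continuous.memLp_of_hasCompactSupport φ.hasCompactSupport

theorem memLp_partialDeriv (φ : 𝓓(Ω, 𝕜)) (i : Fin N) (p : ℝ≥0∞) :
    MemLp (partialDeriv φ i) p (vol Ω) :=
  (continuous_partialDeriv φ i).memLp_of_hasCompactSupport (φ.hasCompactSupport.fderiv_apply ℝ _)

theorem testFunction_eq_zero_of_notMem (φ : 𝓓(Ω, 𝕜)) {x : Vec ℝ N} (hx : x ∉ Ω) : φ x = 0 :=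
  image_eq_zero_of_notMem_tsupport fun h => hx (φ.tsupport_subset h)

theorem integral_mul_partialDeriv (φ ψ : 𝓓(Ω, 𝕜)) (i : Fin N) :
    ∫ x, φ x * partialDeriv ψ i x ∂(vol Ω) = -∫ x, partialDeriv φ i x * ψ x ∂(vol Ω) := by
  rw [setIntegral_eq_integral_of_forall_compl_eq_zero fun x hx => by
      rw [testFunction_eq_zero_of_notMem φ hx, zero_mul],
    setIntegral_eq_integral_of_forall_compl_eq_zero fun x hx => by
      rw [testFunction_eq_zero_of_notMem ψ hx, mul_zero]]
  refine integral_mul_fderiv_eq_neg_fderiv_mul_of_integrable ?_ ?_ ?_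
    (fun x _ => φ.contDiff.differentiable (by simp) x)
    (fun x _ => ψ.contDiff.differentiable (by simp) x)
  · exact ((continuous_partialDeriv φ i).mul ψ.continuous).integrable_of_hasCompactSupport
      ψ.hasCompactSupport.mul_left
  · exact (φ.continuous.mul (continuous_partialDeriv ψ i)).integrable_of_hasCompactSupport
      φ.hasCompactSupport.mul_right
  · exact (φ.continuous.mul ψ.continuous).integrable_of_hasCompactSupport
      φ.hasCompactSupport.mul_right

theorem IsWeakGradient.integral_coord_mul {u : L2 𝕜 Ω} {v : L2Vec 𝕜 Ω} (h : IsWeakGradient u v)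
    {φ : 𝓓(Ω, 𝕜)} (hu : u =ᵐ[vol Ω] φ) (i : Fin N) (ψ : 𝓓(Ω, 𝕜)) :
    ∫ x, v x i * ψ x ∂(vol Ω) = ∫ x, partialDeriv φ i x * ψ x ∂(vol Ω) := by
  rw [← neg_inj, ← h ψ i, ← integral_mul_partialDeriv]
  refine integral_congr_ae ?_
  filter_upwards [hu] with x hx
  rw [hx]

/-- The test function `x ↦ xᵢ * conj (φ x)`, against which the weak gradient of `φ` is tested in
the proof of the Poincaré inequality. -/
noncomputable def coordMulConj (φ : 𝓓(Ω, 𝕜)) (i : Fin N) : 𝓓(Ω, 𝕜) where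
  toFun x := x i • conj (φ x)
  contDiff' := ContDiff.smul (EuclideanSpace.proj (𝕜 := ℝ) i).contDiff
    ((RCLike.conjCLE (K := 𝕜)).contDiff.comp φ.contDiff)
  hasCompactSupport' := φ.hasCompactSupport.mono fun x hx h => hx (by simp [h])
  tsupport_subset' := by
    refine (closure_mono fun x hx => ?_).trans φ.tsupport_subset
    exact fun h => hx (by simp [h])

theorem coordMulConj_apply (φ : 𝓓(Ω, 𝕜)) (i : Fin N) (x : Vec ℝ N) :
    coordMulConj φ i x = x i • conj (φ x) := rfl

theorem partialDeriv_coordMulConj (φ : 𝓓(Ω, 𝕜)) (i : Fin N) (x : Vec ℝ N) :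
    partialDeriv (coordMulConj φ i) i x = conj (φ x) + x i • conj (partialDeriv φ i x) := by
  have hcoord : HasFDerivAt (fun x : Vec ℝ N => x i) (EuclideanSpace.proj (𝕜 := ℝ) i) x :=
    (EuclideanSpace.proj (𝕜 := ℝ) i).hasFDerivAt
  have hφ : HasFDerivAt (φ : Vec ℝ N → 𝕜) (fderiv ℝ φ x) x :=
    (φ.contDiff.differentiable (by simp) x).hasFDerivAt
  have hprod := (hcoord.smul ((RCLike.conjCLE (K := 𝕜)).hasFDerivAt.comp x hφ)).fderiv
  have hcoe : (coordMulConj φ i : Vec ℝ N → 𝕜) =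
      (fun x : Vec ℝ N => x i) • (⇑(RCLike.conjCLE (K := 𝕜)) ∘ φ) := rfl
  rw [partialDeriv, hcoe, hprod]
  simp [partialDeriv, add_comm]

theorem integral_norm_sq_testFunction (φ : 𝓓(Ω, 𝕜)) (i : Fin N) :
    ∫ x, ‖φ x‖ ^ 2 ∂(vol Ω) =
      -2 * RCLike.re (∫ x, partialDeriv φ i x * coordMulConj φ i x ∂(vol Ω)) := by
  set I := ∫ x, partialDeriv φ i x * coordMulConj φ i x ∂(vol Ω)
  have hpointwise (x : Vec ℝ N) : φ x * partialDeriv (coordMulConj φ i) i x =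
      ((‖φ x‖ ^ 2 : ℝ) : 𝕜) + conj (partialDeriv φ i x * coordMulConj φ i x) := by
    simp only [partialDeriv_coordMulConj, coordMulConj_apply, map_mul, RCLike.conj_conj,
      RCLike.conj_ofReal, RCLike.real_smul_eq_coe_mul, mul_add, RCLike.mul_conj,
      RCLike.ofReal_pow]
    ring
  have hparts : ((∫ x, ‖φ x‖ ^ 2 ∂(vol Ω) : ℝ) : 𝕜) + conj I = -I := by
    rw [← integral_mul_partialDeriv, ← integral_conj, ← integral_ofReal, ← integral_add]
    · simp only [hpointwise]
    · exact ((memLp_testFunction φ 2).integrable_norm_pow (by simp)).ofReal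
    · exact RCLike.conjCLE.toContinuousLinearMap.integrable_comp
        ((memLp_partialDeriv φ i 2).integrable_mul (memLp_testFunction (coordMulConj φ i) 2))
  have hre := congrArg RCLike.re hparts
  rw [map_add, map_neg, RCLike.ofReal_re, RCLike.conj_re] at hre
  linarith

theorem norm_integral_coord_mul_coordMulConj_le {u : L2 𝕜 Ω} {φ : 𝓓(Ω, 𝕜)}
    (hu : u =ᵐ[vol Ω] φ) (v : L2Vec 𝕜 Ω) {i : Fin N} {R : ℝ} (hR₀ : 0 ≤ R)
    (hR : ∀ x ∈ Ω, |x i| ≤ R) :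
    ‖∫ x, v x i * coordMulConj φ i x ∂(vol Ω)‖ ≤ R * (‖v‖ * ‖u‖) := by
  calc ‖∫ x, v x i * coordMulConj φ i x ∂(vol Ω)‖
      ≤ ∫ x, R * (‖v x‖ * ‖u x‖) ∂(vol Ω) := by
        refine norm_integral_le_of_norm_le ((integrable_norm_mul_norm v u).const_mul R) ?_
        filter_upwards [hu, ae_restrict_mem Ω.isOpen.measurableSet] with x hx hxΩ
        rw [norm_mul, coordMulConj_apply, norm_smul, RCLike.norm_conj, Real.norm_eq_abs, ← hx,
          mul_left_comm]
        gcongr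
        exacts [hR x hxΩ, PiLp.norm_apply_le _ _]
    _ ≤ R * (‖v‖ * ‖u‖) := by
        rw [integral_const_mul]
        gcongr
        exact integral_norm_mul_norm_le v u

theorem IsWeakGradient.norm_le_of_ae_eq_testFunction {u : L2 𝕜 Ω} {v : L2Vec 𝕜 Ω}
    (h : IsWeakGradient u v) {φ : 𝓓(Ω, 𝕜)} (hu : u =ᵐ[vol Ω] φ) {i : Fin N} {R : ℝ}
    (hR₀ : 0 ≤ R) (hR : ∀ x ∈ Ω, |x i| ≤ R) : ‖u‖ ≤ 2 * R * ‖v‖ := by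
  set I := ∫ x, v x i * coordMulConj φ i x ∂(vol Ω) with hI
  have hnorm : ‖u‖ ^ 2 = -2 * RCLike.re I := by
    rw [hI, h.integral_coord_mul hu, ← integral_norm_sq_testFunction, ← integral_norm_sq_eq_norm_sq]
    refine integral_congr_ae ?_
    filter_upwards [hu] with x hx
    rw [hx]
  have hle : |RCLike.re I| ≤ R * (‖v‖ * ‖u‖) :=
    (RCLike.abs_re_le_norm I).trans (norm_integral_coord_mul_coordMulConj_le hu v hR₀ hR)
  have hsq : ‖u‖ * ‖u‖ ≤ 2 * R * ‖v‖ * ‖u‖ := by linarith [neg_le_of_abs_le hle]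
  rcases (norm_nonneg u).eq_or_lt with hu₀ | hu₀
  · rw [← hu₀]
    positivity
  · exact le_of_mul_le_mul_right hsq hu₀

end Poincare

section Sobolev

theorem continuous_fst_H1 : Continuous fun p : H1 𝕜 Ω => p.1.fst :=
  (WithLp.fstL 2 𝕜 (L2 𝕜 Ω) (L2Vec 𝕜 Ω)).continuous.comp continuous_subtype_val

theorem continuous_snd_H1 : Continuous fun p : H1 𝕜 Ω => p.1.snd :=
  (WithLp.sndL 2 𝕜 (L2 𝕜 Ω) (L2Vec 𝕜 Ω)).continuous.comp continuous_subtype_val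

theorem isClosed_H1 : IsClosed (H1 𝕜 Ω : Set (WithLp 2 (L2 𝕜 Ω × L2Vec 𝕜 Ω))) := by
  have hH1 : (H1 𝕜 Ω : Set (WithLp 2 (L2 𝕜 Ω × L2Vec 𝕜 Ω))) =
      ⋂ (φ : 𝓓(Ω, 𝕜)) (i : Fin N), {p | ∫ x, p.fst x * partialDeriv φ i x ∂(vol Ω) =
        -∫ x, p.snd x i * φ x ∂(vol Ω)} := by
    ext p
    simp only [Set.mem_iInter]
    rfl
  rw [hH1]
  refine isClosed_iInter fun φ => isClosed_iInter fun i => isClosed_eq ?_ ?_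
  · exact (continuous_integral_bilin (ContinuousLinearMap.mul 𝕜 𝕜)
      (memLp_partialDeriv φ i 2)).comp (WithLp.fstL 2 𝕜 (L2 𝕜 Ω) (L2Vec 𝕜 Ω)).continuous
  · exact ((continuous_integral_bilin
      (ContinuousLinearMap.mul 𝕜 𝕜 ∘L EuclideanSpace.proj (𝕜 := 𝕜) i)
      (memLp_testFunction φ 2)).comp (WithLp.sndL 2 𝕜 (L2 𝕜 Ω) (L2Vec 𝕜 Ω)).continuous).neg

instance completeSpace_H1 : CompleteSpace (H1 𝕜 Ω) :=
  isClosed_H1.completeSpace_coe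

instance completeSpace_H10 : CompleteSpace (H10 𝕜 Ω) :=
  (Submodule.isClosed_topologicalClosure _).completeSpace_coe

theorem exists_ae_eq_testFunction_of_mem_span {p : H1 𝕜 Ω}
    (hp : p ∈ Submodule.span 𝕜 {p : H1 𝕜 Ω | ∃ φ : 𝓓(Ω, 𝕜), p.1.fst =ᵐ[vol Ω] φ}) :
    ∃ φ : 𝓓(Ω, 𝕜), p.1.fst =ᵐ[vol Ω] φ := by
  induction hp using Submodule.span_induction with
  | mem _ hp => exact hp
  | zero => exact ⟨0, Lp.coeFn_zero 𝕜 2 (vol Ω)⟩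
  | add p q _ _ hp hq =>
    obtain ⟨φ, hφ⟩ := hp
    obtain ⟨ψ, hψ⟩ := hq
    exact ⟨φ + ψ, (Lp.coeFn_add p.1.fst q.1.fst).trans (hφ.add hψ)⟩
  | smul c p _ hp =>
    obtain ⟨φ, hφ⟩ := hp
    exact ⟨c • φ, (Lp.coeFn_smul c p.1.fst).trans (hφ.const_smul c)⟩

theorem H10_induction {P : H1 𝕜 Ω → Prop} (hclosed : IsClosed {p | P p})
    (htest : ∀ p (φ : 𝓓(Ω, 𝕜)), p.1.fst =ᵐ[vol Ω] φ → P p) {p : H1 𝕜 Ω} (hp : p ∈ H10 𝕜 Ω) :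
    P p :=
  closure_minimal (fun q hq =>
    let ⟨φ, hφ⟩ := exists_ae_eq_testFunction_of_mem_span hq
    htest q φ hφ) hclosed hp

theorem norm_fst_le_norm_grad {i : Fin N} {R : ℝ} (hR₀ : 0 ≤ R) (hR : ∀ x ∈ Ω, |x i| ≤ R)
    (u : H10 𝕜 Ω) : ‖u.1.1.fst‖ ≤ 2 * R * ‖grad 𝕜 Ω u‖ :=
  H10_induction (P := fun p => ‖p.1.fst‖ ≤ 2 * R * ‖p.1.snd‖)
    (isClosed_le continuous_fst_H1.norm (continuous_const.mul continuous_snd_H1.norm))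
    (fun p _ hφ => p.2.norm_le_of_ae_eq_testFunction hφ hR₀ hR) u.2

theorem norm_le_norm_fst_add_norm_grad (u : H10 𝕜 Ω) :
    ‖u‖ ≤ ‖u.1.1.fst‖ + ‖grad 𝕜 Ω u‖ := by
  have hsq : ‖u‖ ^ 2 = ‖u.1.1.fst‖ ^ 2 + ‖grad 𝕜 Ω u‖ ^ 2 := WithLp.prod_norm_sq_eq_of_L2 u.1.1
  refine le_of_sq_le_sq ?_ (by positivity)
  rw [hsq, add_sq']
  exact le_add_of_nonneg_right (by positivity)

variable {i : Fin N} (hΩ : Bornology.IsBounded ((fun x : Vec ℝ N => x i) '' Ω))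

include hΩ in
theorem exists_antilipschitzWith_grad : ∃ K, AntilipschitzWith K (grad 𝕜 Ω) := by
  obtain ⟨R, hR₀, hR⟩ := hΩ.exists_pos_norm_le
  have hcoord : ∀ x ∈ Ω, |x i| ≤ R := fun x hx => hR _ ⟨x, hx, rfl⟩
  refine ⟨Real.toNNReal (2 * R + 1), (grad 𝕜 Ω).antilipschitz_of_bound fun u => ?_⟩
  rw [Real.coe_toNNReal _ (by positivity)]
  refine (norm_le_norm_fst_add_norm_grad u).trans ?_
  linarith [norm_fst_le_norm_grad hR₀.le hcoord u]

include hΩ in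
theorem isClosed_g0 : IsClosed (g0 𝕜 Ω : Set (L2Vec 𝕜 Ω)) :=
  let ⟨_, hK⟩ := exists_antilipschitzWith_grad (𝕜 := 𝕜) hΩ
  hK.isClosed_range (grad 𝕜 Ω).uniformContinuous

include hΩ in
theorem grad_injective : Function.Injective (grad 𝕜 Ω) :=
  let ⟨_, hK⟩ := exists_antilipschitzWith_grad (𝕜 := 𝕜) hΩ
  hK.injective

/-- The gradient as an isomorphism of `H¹₀(Ω)` onto `g₀(Ω)`, for `Ω` bounded in the direction of
the `i`-th coordinate. -/
noncomputable def gradEquiv : H10 𝕜 Ω ≃L[𝕜] g0 𝕜 Ω where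
  toLinearEquiv := LinearEquiv.ofInjective (grad 𝕜 Ω).toLinearMap (grad_injective hΩ)
  continuous_toFun := (grad 𝕜 Ω).continuous.subtype_mk _
  continuous_invFun := by
    obtain ⟨K, hK⟩ := exists_antilipschitzWith_grad (𝕜 := 𝕜) hΩ
    let e := LinearEquiv.ofInjective (grad 𝕜 Ω).toLinearMap (grad_injective hΩ)
    have he : AntilipschitzWith K e := hK
    exact (he.to_rightInverse e.apply_symm_apply).continuous

theorem iota_gradEquiv (u : H10 𝕜 Ω) : iota 𝕜 Ω (gradEquiv hΩ u) = grad 𝕜 Ω u := rfl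

theorem grad_gradEquiv_symm (g : g0 𝕜 Ω) : grad 𝕜 Ω ((gradEquiv hΩ).symm g) = iota 𝕜 Ω g := by
  rw [← iota_gradEquiv hΩ, ContinuousLinearEquiv.apply_symm_apply]

end Sobolev

section Compression

/-- Uniform ellipticity `Re a(x) ≥ α` for almost every `x ∈ Ω`: the lower of the two bounds that
define `M(α, β, Ω)`. -/
def IsElliptic (α : ℝ) (a : Coeff 𝕜 Ω) : Prop :=
  ∀ᵐ x ∂(vol Ω), ∀ ξ : Vec 𝕜 N, α * ‖ξ‖ ^ 2 ≤ RCLike.re (inner 𝕜 (a x ξ) ξ)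

theorem isElliptic_of_mem_M {α β : ℝ} {a : Coeff 𝕜 Ω} (ha : a ∈ M 𝕜 α β Ω) : IsElliptic α a :=
  Eventually.mono ha fun _ hx => hx.2.1

theorem coeFn_mulOp (a : Coeff 𝕜 Ω) (q : L2Vec 𝕜 Ω) :
    mulOp a q =ᵐ[vol Ω] fun x => a x (q x) :=
  (ContinuousLinearMap.id 𝕜 (Vec 𝕜 N →L[𝕜] Vec 𝕜 N)).coeFn_holder (r := 2) a q

theorem IsElliptic.le_re_inner_mulOp {α : ℝ} {a : Coeff 𝕜 Ω} (ha : IsElliptic α a)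
    (q : L2Vec 𝕜 Ω) : α * ‖q‖ ^ 2 ≤ RCLike.re (inner 𝕜 (mulOp a q) q) := by
  rw [← integral_norm_sq_eq_norm_sq, ← integral_const_mul, L2.inner_def,
    ← integral_re (L2.integrable_inner _ _)]
  refine integral_mono_ae (((Lp.memLp q).integrable_norm_pow (by simp)).const_mul _)
    (L2.integrable_inner _ _).re ?_
  filter_upwards [ha, coeFn_mulOp a q] with x hx hq
  simp only [hq]
  exact hx (q x)

theorem isInvertible_of_coercive {E : Type*} [NormedAddCommGroup E] [InnerProductSpace 𝕜 E]
    [CompleteSpace E] {T : E →L[𝕜] E} {α : ℝ} (hα : 0 < α)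
    (hT : ∀ x, α * ‖x‖ ^ 2 ≤ RCLike.re (inner 𝕜 (T x) x)) : T.IsInvertible := by
  obtain ⟨e, he⟩ : IsUnit T := by
    refine T.isUnit_of_forall_le_norm_inner_map (Real.toNNReal_pos.2 hα) fun x => ?_
    rw [mul_comm, Real.coe_toNNReal _ hα.le]
    exact (hT x).trans (RCLike.re_le_norm _)
  exact ⟨ContinuousLinearEquiv.unitsEquiv 𝕜 _ e, he⟩

theorem IsElliptic.isInvertible_compression [CompleteSpace (g0 𝕜 Ω)] {α : ℝ} (hα : 0 < α)
    {a : Coeff 𝕜 Ω} (ha : IsElliptic α a) : (compression a).IsInvertible := by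
  refine isInvertible_of_coercive hα fun g => ?_
  have hadjoint : inner 𝕜 (compression a g) g = inner 𝕜 (mulOp a (iota 𝕜 Ω g)) (iota 𝕜 Ω g) :=
    (iota 𝕜 Ω).adjoint_inner_left g (mulOp a (iota 𝕜 Ω g))
  rw [hadjoint]
  exact ha.le_re_inner_mulOp (iota 𝕜 Ω g)

end Compression

section SolutionOperator

/-- The functional `φ ↦ ⟨q, grad φ⟩` in `H⁻¹(Ω)`, that is, the distribution `-div q`, up to the
complex conjugation in the antilinear argument of the inner product. -/
noncomputable def negDiv (q : L2Vec 𝕜 Ω) : StrongDual 𝕜 (H10 𝕜 Ω) :=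
  innerSL 𝕜 q ∘L grad 𝕜 Ω

theorem isSolution_iff_negDiv_eq {a : Coeff 𝕜 Ω} {f : StrongDual 𝕜 (H10 𝕜 Ω)} {u : H10 𝕜 Ω} :
    IsSolution a f u ↔ negDiv (mulOp a (grad 𝕜 Ω u)) = f :=
  (ContinuousLinearMap.ext_iff (f := negDiv (mulOp a (grad 𝕜 Ω u)))).symm

theorem negDiv_iota_injective : Function.Injective fun g : g0 𝕜 Ω => negDiv (iota 𝕜 Ω g) := by
  refine fun g g' h => ext_inner_right 𝕜 ?_
  rintro ⟨_, φ, rfl⟩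
  exact DFunLike.congr_fun h φ

theorem negDiv_iota_adjoint [CompleteSpace (g0 𝕜 Ω)] (q : L2Vec 𝕜 Ω) :
    negDiv (iota 𝕜 Ω ((iota 𝕜 Ω).adjoint q)) = negDiv q :=
  ContinuousLinearMap.ext fun φ =>
    (iota 𝕜 Ω).adjoint_inner_left ⟨grad 𝕜 Ω φ, φ, rfl⟩ q

variable [CompleteSpace (g0 𝕜 Ω)] {i : Fin N}
  (hΩ : Bornology.IsBounded ((fun x : Vec ℝ N => x i) '' Ω))

include hΩ in
theorem negDiv_iota_surjective : Function.Surjective fun g : g0 𝕜 Ω => negDiv (iota 𝕜 Ω g) := by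
  intro f
  let ℓ : StrongDual 𝕜 (g0 𝕜 Ω) := f ∘L (gradEquiv (𝕜 := 𝕜) hΩ).symm.toContinuousLinearMap
  refine ⟨(InnerProductSpace.toDual 𝕜 _).symm ℓ, ContinuousLinearMap.ext fun φ => ?_⟩
  calc negDiv (iota 𝕜 Ω ((InnerProductSpace.toDual 𝕜 _).symm ℓ)) φ
      = inner 𝕜 ((InnerProductSpace.toDual 𝕜 _).symm ℓ) (gradEquiv hΩ φ) := rfl
    _ = f φ := by simp [ℓ]

/-- The operator that takes `g ∈ g₀(Ω)` to the solution `u ∈ H¹₀(Ω)` of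
`⟨a grad u, grad φ⟩ = ⟨g, grad φ⟩`. It is zero if `ι* a ι` is not invertible. -/
noncomputable def solutionOp (a : Coeff 𝕜 Ω) : g0 𝕜 Ω →L[𝕜] H10 𝕜 Ω :=
  (gradEquiv (𝕜 := 𝕜) hΩ).symm.toContinuousLinearMap ∘L (compression a).inverse

theorem grad_solutionOp (a : Coeff 𝕜 Ω) (g : g0 𝕜 Ω) :
    grad 𝕜 Ω (solutionOp hΩ a g) = iota 𝕜 Ω ((compression a).inverse g) :=
  grad_gradEquiv_symm hΩ _

theorem isSolution_negDiv_iota_iff {a : Coeff 𝕜 Ω} (ha : (compression a).IsInvertible)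
    {g : g0 𝕜 Ω} {u : H10 𝕜 Ω} :
    IsSolution a (negDiv (iota 𝕜 Ω g)) u ↔ u = solutionOp hΩ a g := by
  calc IsSolution a (negDiv (iota 𝕜 Ω g)) u
      ↔ negDiv (iota 𝕜 Ω (compression a (gradEquiv hΩ u))) = negDiv (iota 𝕜 Ω g) := by
        rw [isSolution_iff_negDiv_eq, ← negDiv_iota_adjoint]
        rfl
    _ ↔ compression a (gradEquiv hΩ u) = g := negDiv_iota_injective.eq_iff
    _ ↔ gradEquiv hΩ u = (compression a).inverse g := by
        rw [eq_comm (a := gradEquiv hΩ u), ha.inverse_apply_eq, eq_comm]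
    _ ↔ u = solutionOp hΩ a g := (gradEquiv hΩ).eq_symm_apply.symm

end SolutionOperator

section WeakConvergence

variable {H K : Type*} [NormedAddCommGroup H] [InnerProductSpace 𝕜 H] [NormedAddCommGroup K]
  [InnerProductSpace 𝕜 K]

theorem weaklyTendsto_iff_forall_dual {x : ℕ → H} {y : H} :
    WeaklyTendsto 𝕜 x y ↔ ∀ l : StrongDual 𝕜 H, Tendsto (fun n => l (x n)) atTop (𝓝 (l y)) := by
  refine WeakBilin.tendsto_iff_forall_eval_tendsto (topDualPairing 𝕜 H).flip fun x y hxy => ?_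
  exact (SeparatingDual.eq_iff_forall_dual_eq (R := 𝕜)).2 fun l => LinearMap.congr_fun hxy l

theorem WeaklyTendsto.map {x : ℕ → H} {y : H} (h : WeaklyTendsto 𝕜 x y) (T : H →L[𝕜] K) :
    WeaklyTendsto 𝕜 (fun n => T (x n)) (T y) :=
  weaklyTendsto_iff_forall_dual.2 fun l => weaklyTendsto_iff_forall_dual.1 h (l ∘L T)

theorem weaklyTendsto_equiv_apply_iff (e : H ≃L[𝕜] K) {x : ℕ → H} {y : H} :
    WeaklyTendsto 𝕜 (fun n => e (x n)) (e y) ↔ WeaklyTendsto 𝕜 x y := by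
  refine ⟨fun h => ?_, fun h => h.map (e : H →L[𝕜] K)⟩
  simpa only [ContinuousLinearEquiv.coe_coe, ContinuousLinearEquiv.symm_apply_apply] using
    h.map (e.symm : K →L[𝕜] H)

theorem wotTendsto_iff_forall_weaklyTendsto {T : ℕ → H →L[𝕜] K} {S : H →L[𝕜] K} :
    WOTTendsto T S ↔ ∀ x, WeaklyTendsto 𝕜 (fun n => T n x) (S x) := by
  simp only [weaklyTendsto_iff_forall_dual]
  exact ContinuousLinearMapWOT.tendsto_iff_forall_dual_apply_tendsto

end WeakConvergence

section Convergence

variable [CompleteSpace (g0 𝕜 Ω)] {i : Fin N}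
  (hΩ : Bornology.IsBounded ((fun x : Vec ℝ N => x i) '' Ω)) {a : ℕ → Coeff 𝕜 Ω} {b : Coeff 𝕜 Ω}
  (ha : ∀ n, (compression (a n)).IsInvertible) (hb : (compression b).IsInvertible)

include ha in
theorem forall_isSolution_negDiv_iota_iff {g : g0 𝕜 Ω} {u : ℕ → H10 𝕜 Ω} :
    (∀ n, IsSolution (a n) (negDiv (iota 𝕜 Ω g)) (u n)) ↔ u = fun n => solutionOp hΩ (a n) g :=
  (forall_congr' fun n => isSolution_negDiv_iota_iff hΩ (ha n)).trans funext_iff.symm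

include ha hb in
theorem gConverges_iff_forall_weaklyTendsto_solutionOp :
    GConverges a b ↔
      ∀ g, WeaklyTendsto 𝕜 (fun n => solutionOp hΩ (a n) g) (solutionOp hΩ b g) := by
  simp only [GConverges, (negDiv_iota_surjective hΩ).forall,
    forall_isSolution_negDiv_iota_iff hΩ ha, isSolution_negDiv_iota_iff hΩ hb, forall_eq,
    exists_eq_right]

include ha hb in
theorem hConverges_iff_forall_weaklyTendsto_solutionOp :
    HConverges a b ↔ ∀ g,
      WeaklyTendsto 𝕜 (fun n => solutionOp hΩ (a n) g) (solutionOp hΩ b g) ∧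
      WeaklyTendsto 𝕜 (fun n => mulOp (a n) (grad 𝕜 Ω (solutionOp hΩ (a n) g)))
        (mulOp b (grad 𝕜 Ω (solutionOp hΩ b g))) := by
  simp only [HConverges, (negDiv_iota_surjective hΩ).forall,
    forall_isSolution_negDiv_iota_iff hΩ ha, isSolution_negDiv_iota_iff hΩ hb, forall_eq,
    ← and_assoc, exists_eq_right]

theorem weaklyTendsto_solutionOp_iff {g : g0 𝕜 Ω} :
    WeaklyTendsto 𝕜 (fun n => solutionOp hΩ (a n) g) (solutionOp hΩ b g) ↔
      WeaklyTendsto 𝕜 (fun n => (compression (a n)).inverse g) ((compression b).inverse g) := by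
  simp only [solutionOp, ContinuousLinearMap.comp_apply, ContinuousLinearEquiv.coe_coe,
    weaklyTendsto_equiv_apply_iff]

end Convergence

end Homogenisation

theorem mainTheorem3_general {𝕜 : Type*} [RCLike 𝕜] {N : ℕ}
    (Ω : TopologicalSpace.Opens (EuclideanSpace ℝ (Fin N))) {i : Fin N}
    (hΩ : Bornology.IsBounded ((fun x : EuclideanSpace ℝ (Fin N) => x i) '' Ω)) :
    ∃ _ : CompleteSpace (g0 𝕜 Ω),
      (∀ (α : ℝ) (c : Coeff 𝕜 Ω), 0 < α → IsElliptic α c → (compression c).IsInvertible) ∧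
      (∀ (a : ℕ → Coeff 𝕜 Ω) (b : Coeff 𝕜 Ω),
        (∀ n, (compression (a n)).IsInvertible) → (compression b).IsInvertible →
        (GConverges a b ↔
          WOTTendsto (fun n => (compression (a n)).inverse) (compression b).inverse)) ∧
      (∀ (a : ℕ → Coeff 𝕜 Ω) (b : Coeff 𝕜 Ω),
        (∀ n, (compression (a n)).IsInvertible) → (compression b).IsInvertible →
        (HConverges a b ↔
          WOTTendsto (fun n => (compression (a n)).inverse) (compression b).inverse ∧
          WOTTendsto (fun n => mulOp (a n) ∘L iota 𝕜 Ω ∘L (compression (a n)).inverse)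
            (mulOp b ∘L iota 𝕜 Ω ∘L (compression b).inverse))) := by
  have hg0 : CompleteSpace (g0 𝕜 Ω) := (isClosed_g0 hΩ).completeSpace_coe
  refine ⟨hg0, fun α c hα hc => hc.isInvertible_compression hα, fun a b ha hb => ?_,
    fun a b ha hb => ?_⟩
  · simp only [gConverges_iff_forall_weaklyTendsto_solutionOp hΩ ha hb,
      weaklyTendsto_solutionOp_iff, wotTendsto_iff_forall_weaklyTendsto]
  · simp only [hConverges_iff_forall_weaklyTendsto_solutionOp hΩ ha hb,
      weaklyTendsto_solutionOp_iff, grad_solutionOp, wotTendsto_iff_forall_weaklyTendsto,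
      forall_and, ContinuousLinearMap.comp_apply]

theorem mainTheorem3 {𝕜 : Type*} [RCLike 𝕜] {N : ℕ} (hN : 1 ≤ N)
    (Ω : TopologicalSpace.Opens (EuclideanSpace ℝ (Fin N)))
    (hΩ : Bornology.IsBounded (Ω : Set (EuclideanSpace ℝ (Fin N))))
    {α β : ℝ} (hα : 0 < α) (hαβ : α < β) :
    -- `g₀(Ω)` is a Hilbert space and the inverses below are genuine inverses
    ∃ _ : CompleteSpace (g0 𝕜 Ω),
      (∀ c ∈ M 𝕜 α β Ω, (compression c).IsInvertible) ∧
      -- (a)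
      (∀ (a : ℕ → Coeff 𝕜 Ω) (b : Coeff 𝕜 Ω),
        (∀ n, a n ∈ Msym 𝕜 α β Ω) → b ∈ Msym 𝕜 α β Ω →
        (GConverges a b ↔
          WOTTendsto (fun n => (compression (a n)).inverse) (compression b).inverse)) ∧
      -- (b)
      (∀ (a : ℕ → Coeff 𝕜 Ω) (b : Coeff 𝕜 Ω),
        (∀ n, a n ∈ M 𝕜 α β Ω) → b ∈ M 𝕜 α β Ω →
        (HConverges a b ↔
          WOTTendsto (fun n => (compression (a n)).inverse) (compression b).inverse ∧
          WOTTendsto (fun n => mulOp (a n) ∘L iota 𝕜 Ω ∘L (compression (a n)).inverse)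
            (mulOp b ∘L iota 𝕜 Ω ∘L (compression b).inverse))) := by
  obtain ⟨hg0, hinv, hG, hH⟩ := mainTheorem3_general (𝕜 := 𝕜) Ω (i := ⟨0, hN⟩)
    ((EuclideanSpace.proj (𝕜 := ℝ) (⟨0, hN⟩ : Fin N)).lipschitz.isBounded_image hΩ)
  have hM : ∀ c ∈ M 𝕜 α β Ω, (compression c).IsInvertible :=
    fun c hc => hinv α c hα (isElliptic_of_mem_M hc)
  exact ⟨hg0, hM, fun a b ha hb => hG a b (fun n => hM _ (ha n).1) (hM _ hb.1),
    fun a b ha hb => hH a b (fun n => hM _ (ha n)) (hM _ hb)⟩
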